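/- Let $\mathbb{V}$ be a finitary one-sorted variety of universal algebras, regarded as a (finitely complete) category whose morphisms are the homomorphisms. A \emph{regular relation} on an object $X$ is a monomorphism $r\colon R\rightarrowtail X\times X$ which is an equalizer of some parallel pair of morphisms $X\times X\rightrightarrows Z$. The category $\mathbb{V}$ is called \emph{$\mathcal{M}_{\mathrm{reg}}$-Mal'tsev} if every reflexive regular relation $r\colon R\rightarrowtail X\times X$ in $\mathbb{V}$ is an equivalence relation. Then $\mathbb{V}$ is an $\mathcal{M}_{\mathrm{reg}}$-Mal'tsev category if and only if there exist integers $k,m,N\geqslant 0$, binary terms $f_1,g_1,\ldots,f_k,g_k$, ternary terms $p_1,\ldots,p_m$, $(2(k+2m+1))$-ary terms $s_1,\ldots,s_N$, $(2(k+m+2))$-ary terms $\sigma_1,\ldots,\sigma_{N+1}$ and, for all $i\in\{1,\ldots,N+1\}$, $(k+m+1)$-ary terms $\eta^{(i)}_1,\eta^{(i)}_2,\epsilon^{(i)}_1,\epsilon^{(i)}_2$ such that the following identities, in the variables $x,y,u,u'$, $\vec v=(v_1,\ldots,v_k)$, $\vec v'=(v_1',\ldots,v_k')$, $\vec w=(w_1,\ldots,w_m)$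 and $\vec w'=(w_1',\ldots,w_m')$, hold in $\mathbb{V}$: \begin{align*} \eta^{(i)}_\alpha(y,f_1(x,y),\ldots,f_k(x,y),p_1(x,x,y),\ldots,p_m(x,x,y))&=\epsilon^{(i)}_\alpha(y,f_1(x,y),\ldots,f_k(x,y),p_1(x,x,y),\ldots,p_m(x,x,y)),\\ \eta^{(i)}_\alpha(x,g_1(x,y),\ldots,g_k(x,y),p_1(x,y,y),\ldots,p_m(x,y,y))&=\epsilon^{(i)}_\alpha(x,g_1(x,y),\ldots,g_k(x,y),p_1(x,y,y),\ldots,p_m(x,y,y)) \end{align*} for all $i\in\{1,\ldots,N+1\}$ and $\alpha\in\{1,2\}$; \begin{align*} \sigma_{i}(u,\vec{v},\vec{w},u',\vec{v}',\vec{w}',\epsilon^{(i)}_1(u,\vec{v},\vec{w}),\epsilon^{(i)}_2(u',\vec{v}',\vec{w}'))&=s_{i}(u,\vec{v},\vec{w},\vec{w},u',\vec{v}',\vec{w}',\vec{w}'),\\ s_{i}(u,\vec{v},\vec{w},\vec{w}',u',\vec{v}',\vec{w}',\vec{w})&=\sigma_{i+1}(u,\vec{v},\vec{w},u',\vec{v}',\vec{w}',\eta^{(i+1)}_1(u,\vec{v},\vec{w}),\eta^{(i+1)}_2(u',\vec{v}',\vec{w}'))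 \end{align*} for all $i\in\{1,\ldots,N\}$; and \begin{align*} u&=\sigma_1(u,\vec{v},\vec{w},u',\vec{v}',\vec{w}',\eta^{(1)}_1(u,\vec{v},\vec{w}),\eta^{(1)}_2(u',\vec{v}',\vec{w}')),\\ u'&=\sigma_{N+1}(u,\vec{v},\vec{w},u',\vec{v}',\vec{w}',\epsilon^{(N+1)}_1(u,\vec{v},\vec{w}),\epsilon^{(N+1)}_2(u',\vec{v}',\vec{w}')). \end{align*} -/

import Mathlib

universe u v w

open CategoryTheory CategoryTheory.Limits
open scoped FirstOrder

/-- The variety (as a category) of all algebras over the finitary one-sorted signature `L` that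
satisfy the set `E` of identities. The signature is a language (to be used with `L.IsAlgebraic`,
i.e. without relation symbols); an identity is a pair of terms in variables indexed by `ℕ`.
Algebras may be empty. The universe of the algebras is at least that of the signature, so that the
free algebras belong to the category. -/
structure VarietyCat {L : FirstOrder.Language.{u, v}} (E : Set (L.Term ℕ × L.Term ℕ)) :
    Type (max (u + 1) v (w + 1)) where
  carrier : Type (max u w)
  [str : L.Structure carrier]
  sat : ∀ e ∈ E, ∀ a : ℕ → carrier, e.1.realize a = e.2.realize a

namespace VarietyCat

variable {L : FirstOrder.Language.{u, v}} {E : Set (L.Term ℕ × L.Term ℕ)}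

instance : CoeSort (VarietyCat.{u, v, w} E) (Type (max u w)) := ⟨carrier⟩

attribute [instance] str

/-- Morphisms are the homomorphisms of algebras. -/
instance : Category (VarietyCat.{u, v, w} E) where
  Hom A B := A →[L] B
  id A := FirstOrder.Language.Hom.id L A
  comp f g := FirstOrder.Language.Hom.comp g f

/-- The algebra of compatible families of a diagram of algebras. -/
def Sections {J : Type} [SmallCategory J] (F : J ⥤ VarietyCat.{u, v, w} E) : Type (max u w) :=
  {x : ∀ j, F.obj j // ∀ ⦃i j : J⦄ (h : i ⟶ j), (show F.obj i →[L] F.obj j from F.map h) (x i) = x j}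

instance {J : Type} [SmallCategory J] (F : J ⥤ VarietyCat.{u, v, w} E) :
    L.Structure (Sections F) where
  funMap f xs := ⟨fun j => FirstOrder.Language.Structure.funMap f (fun i => (xs i).1 j), fun i j h => by
    rw [FirstOrder.Language.Hom.map_fun]
    congr 1
    funext a
    exact (xs a).2 h⟩
  RelMap r xs := ∀ j, FirstOrder.Language.Structure.RelMap r (fun i => (xs i).1 j)

/-- The projections of the algebra of compatible families. -/
def Sections.proj {J : Type} [SmallCategory J] (F : J ⥤ VarietyCat.{u, v, w} E) (j : J) :
    Sections F →[L] F.obj j where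
  toFun x := x.1 j
  map_fun' _ _ := rfl
  map_rel' _ _ h := h j

/-- Varieties are finitely complete. -/
instance : HasFiniteLimits (VarietyCat.{u, v, w} E) where
  out J _ _ :=
    { has_limit := fun F => ⟨⟨{
        cone :=
          { pt :=
              { carrier := Sections F
                sat := fun e he a => by
                  apply Subtype.ext
                  funext j
                  have h1 := FirstOrder.Language.HomClass.realize_term (Sections.proj F j) (t := e.1) (v := a)
                  have h2 := FirstOrder.Language.HomClass.realize_term (Sections.proj F j) (t := e.2) (v := a)
                  have h3 := (F.obj j).sat e he (Sections.proj F j ∘ a)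
                  exact h1.symm.trans (h3.trans h2) }
            π :=
              { app := Sections.proj F
                naturality := fun i j h => FirstOrder.Language.Hom.ext fun x => (x.2 h).symm } }
        isLimit :=
          { lift := fun c =>
              { toFun := fun x => ⟨fun j => (show c.pt →[L] F.obj j from c.π.app j) x,
                  fun i j h => DFunLike.congr_fun (F := c.pt →[L] F.obj j) (c.w h) x⟩
                map_fun' := fun f x => by
                  apply Subtype.ext
                  funext j
                  exact FirstOrder.Language.Hom.map_fun (show c.pt →[L] F.obj j from c.π.app j) f x
                map_rel' := fun r x h j =>
                  FirstOrder.Language.Hom.map_rel (show c.pt →[L] F.obj j from c.π.app j) r x h }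
            fac := fun c j => rfl
            uniq := fun c m hm => by
              refine FirstOrder.Language.Hom.ext fun x => Subtype.ext (funext fun j => ?_)
              exact DFunLike.congr_fun (F := c.pt →[L] F.obj j) (hm j) x } }⟩⟩ }

end VarietyCat

section Relations

variable {C : Type*} [Category C] [HasFiniteLimits C]

/-- The generalized elements `a` of `X` and `b` of `Y` are related by `r : R ⟶ X ⨯ Y`. -/
def RelatedBy {R X Y : C} (r : R ⟶ X ⨯ Y) {T : C} (a : T ⟶ X) (b : T ⟶ Y) : Prop :=
  ∃ c : T ⟶ R, c ≫ r = prod.lift a b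

/-- The relation `r : R ⟶ X ⨯ X` is reflexive. -/
def IsReflexiveRelation {R X : C} (r : R ⟶ X ⨯ X) : Prop :=
  ∀ (T : C) (a : T ⟶ X), RelatedBy r a a

/-- The relation `r : R ⟶ X ⨯ X` is an equivalence relation (reflexive, symmetric and transitive
on generalized elements). -/
def IsEquivalenceRelation {R X : C} (r : R ⟶ X ⨯ X) : Prop :=
  ∀ T : C, _root_.Equivalence (fun a b : T ⟶ X => RelatedBy r a b)

variable (C) in
/-- A finitely complete category is `M_reg`-Mal'tsev if every reflexive regular relation
(regular monomorphism `R ⟶ X ⨯ X`) is an equivalence relation. -/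
def IsRegMaltsev : Prop :=
  ∀ ⦃R X : C⦄ (r : R ⟶ X ⨯ X), IsRegularMono r → IsReflexiveRelation r → IsEquivalenceRelation r

end Relations

/-- The `k + m + 1` variables `u, v₁, …, vₖ, w₁, …, wₘ`. -/
abbrev Vars (k m : ℕ) : Type := Unit ⊕ Fin k ⊕ Fin m

/-- The tuple `(u, v⃗, w⃗)` of arguments of a `(k + m + 1)`-ary term. -/
def args {A : Type*} {k m : ℕ} (u : A) (v : Fin k → A) (w : Fin m → A) : Vars k m → A :=
  Sum.elim (fun _ => u) (Sum.elim v w)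

/-- The `2 (k + 2 m + 1)` variables of the terms `s`. -/
abbrev SVars (k m : ℕ) : Type := (Vars k m ⊕ Fin m) ⊕ (Vars k m ⊕ Fin m)

/-- The tuple `(u, v⃗, w⃗, z⃗, u', v⃗', w⃗', z⃗')` of arguments of a `2 (k + 2 m + 1)`-ary term. -/
def sArgs {A : Type*} {k m : ℕ} (u : A) (v : Fin k → A) (w z : Fin m → A)
    (u' : A) (v' : Fin k → A) (w' z' : Fin m → A) : SVars k m → A :=
  Sum.elim (Sum.elim (args u v w) z) (Sum.elim (args u' v' w') z')

/-- The `2 (k + m + 2)` variables of the terms `σ`. -/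
abbrev SigmaVars (k m : ℕ) : Type := (Vars k m ⊕ Vars k m) ⊕ Fin 2

/-- The tuple `(u, v⃗, w⃗, u', v⃗', w⃗', a, b)` of arguments of a `2 (k + m + 2)`-ary term. -/
def sigmaArgs {A : Type*} {k m : ℕ} (u : A) (v : Fin k → A) (w : Fin m → A)
    (u' : A) (v' : Fin k → A) (w' : Fin m → A) (a b : A) : SigmaVars k m → A :=
  Sum.elim (Sum.elim (args u v w) (args u' v' w')) ![a, b]

-- Sufficiency. Present a regular relation as the equalizer of `h₁, h₂ : X ⨯ Y ⟶ Z`, and let it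
-- contain `(x₁, y₁)`, `(x₁, y₂)`, `(x₂, y₂)`. Take `u`, `v⃗`, `w⃗` to be the images under `h₁` of
-- `(x₂, y₁)`, `(f_j(x₁, x₂), g_j(y₁, y₂))`, `(p_j(x₁, x₁, x₂), p_j(y₁, y₂, y₂))`, and `u'`, `v⃗'`,
-- `w⃗'` their images under `h₂`. The third kind of pair is generated by the given ones, so `w⃗ =
-- w⃗'`; the identities in `x, y` give `η = ε` on both sides, and the chain collapses to `u = u'`.
-- So the relation is difunctional (`difunctional_of_terms`); a reflexive difunctional relation is
-- an equivalence.
--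
-- Necessity. Let `X` be free on `x, y`, and let `S ⊆ X²` be generated by `(x, x), (x, y), (y, y)`.
-- The equalizer of the cokernel pair of `S ⊆ X²` is a reflexive regular relation containing `(x,
-- y)`, so by symmetry it contains `(y, x)`: the two copies of `(y, x)` agree in the cokernel pair.
-- Building the latter as a quotient of a term algebra (`exists_termQuotient`, `cokerRel`) turns
-- this equality into a finite chain of elementary steps (`cokerRel.exists_chain`), from which the
-- terms are read off. Only finitely many names of pairs matter.

universe x

open FirstOrder FirstOrder.Language FirstOrder.Language.Structure

namespace VarietyCat

variable {L : FirstOrder.Language.{u, v}} {E : Set (L.Term ℕ × L.Term ℕ)}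

section Morphisms

/-- The homomorphism underlying a morphism of the variety. -/
def toHom {A B : VarietyCat.{u, v, w} E} (f : A ⟶ B) : A →[L] B := f

theorem hom_ext {A B : VarietyCat.{u, v, w} E} {f g : A ⟶ B}
    (h : ∀ a, toHom f a = toHom g a) : f = g :=
  FirstOrder.Language.Hom.ext h

theorem toHom_comp {A B C : VarietyCat.{u, v, w} E} (f : A ⟶ B) (g : B ⟶ C) (a : A) :
    toHom (f ≫ g) a = toHom g (toHom f a) := rfl

theorem toHom_congr {A B : VarietyCat.{u, v, w} E} {f g : A ⟶ B} (h : f = g) (a : A) :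
    toHom f a = toHom g a := by rw [h]

theorem toHom_realize {A B : VarietyCat.{u, v, w} E} (f : A ⟶ B) {α : Type x} (t : L.Term α)
    (a : α → A) : toHom f (t.realize a) = t.realize (toHom f ∘ a) :=
  (HomClass.realize_term (toHom f)).symm

/-- A map commuting with the operations, as a morphism of the variety. -/
def ofMap [L.IsAlgebraic] {A B : VarietyCat.{u, v, w} E} (f : A → B)
    (hf : ∀ {n} (c : L.Functions n) (a : Fin n → A), f (funMap c a) = funMap c (f ∘ a)) :
    A ⟶ B :=
  show A →[L] B from { toFun := f, map_fun' := hf, map_rel' := fun r => isEmptyElim r }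

end Morphisms

/-! ### Elements of categorical products and coordinatewise evaluation of terms. -/

section Products

variable (X Y : VarietyCat.{u, v, w} E)

instance prodStructure : L.Structure (X × Y) where
  funMap c a := (funMap c fun i => (a i).1, funMap c fun i => (a i).2)
  RelMap r a := RelMap r (fun i => (a i).1) ∧ RelMap r (fun i => (a i).2)

variable {X Y} in
theorem realize_prod {α : Type x} (t : L.Term α) (a : α → X × Y) :
    t.realize a = (t.realize fun i => (a i).1, t.realize fun i => (a i).2) := by
  induction t with
  | var => rfl
  | func c ts ih => simp only [Term.realize_func, ih]; rfl

/-- The algebra of pairs. -/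
def prodAlg : VarietyCat.{u, v, w} E where
  carrier := X × Y
  sat e he a := by rw [realize_prod, realize_prod, X.sat e he, Y.sat e he]

/-- The comparison morphism from the algebra of pairs to the categorical product. -/
noncomputable def prodAlgHom : prodAlg X Y ⟶ X ⨯ Y :=
  prod.lift
    (show prodAlg X Y →[L] X from
      { toFun := Prod.fst, map_fun' := fun _ _ => rfl, map_rel' := fun _ _ h => h.1 })
    (show prodAlg X Y →[L] Y from
      { toFun := Prod.snd, map_fun' := fun _ _ => rfl, map_rel' := fun _ _ h => h.2 })

variable {X Y}

/-- The element of the categorical product with given coordinates. -/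
noncomputable def pair (x : X) (y : Y) : (X ⨯ Y : VarietyCat.{u, v, w} E) :=
  toHom (prodAlgHom X Y) ((x, y) : X × Y)

theorem fst_pair (x : X) (y : Y) :
    toHom (prod.fst : X ⨯ Y ⟶ X) (pair x y) = x := by
  have h : prodAlgHom X Y ≫ prod.fst = _ := prod.lift_fst _ _
  exact toHom_congr h ((x, y) : X × Y)

theorem snd_pair (x : X) (y : Y) :
    toHom (prod.snd : X ⨯ Y ⟶ Y) (pair x y) = y := by
  have h : prodAlgHom X Y ≫ prod.snd = _ := prod.lift_snd _ _
  exact toHom_congr h ((x, y) : X × Y)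

/-- The morphism into the algebra of pairs with given coordinates. -/
def liftAlg {T : VarietyCat.{u, v, w} E} (a : T ⟶ X) (b : T ⟶ Y) : T ⟶ prodAlg X Y :=
  show T →[L] prodAlg X Y from
    { toFun := fun t => ((toHom a t, toHom b t) : X × Y)
      map_fun' := fun c t => Prod.ext (Hom.map_fun (toHom a) c t) (Hom.map_fun (toHom b) c t)
      map_rel' := fun r t h => ⟨Hom.map_rel (toHom a) r t h, Hom.map_rel (toHom b) r t h⟩ }

theorem toHom_lift {T : VarietyCat.{u, v, w} E} (a : T ⟶ X) (b : T ⟶ Y) (t : T) :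
    toHom (prod.lift a b) t = pair (toHom a t) (toHom b t) := by
  have h : prod.lift a b = liftAlg a b ≫ prodAlgHom X Y := by
    apply Limits.prod.hom_ext
    · rw [prod.lift_fst, Category.assoc, prodAlgHom, prod.lift_fst]; rfl
    · rw [prod.lift_snd, Category.assoc, prodAlgHom, prod.lift_snd]; rfl
  exact toHom_congr h t

theorem pair_fst_snd (z : (X ⨯ Y : VarietyCat.{u, v, w} E)) :
    pair (toHom (prod.fst : X ⨯ Y ⟶ X) z) (toHom (prod.snd : X ⨯ Y ⟶ Y) z) = z := by
  rw [← toHom_lift]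
  exact toHom_congr (Limits.prod.lift_fst_snd (X := X) (Y := Y)) z

theorem pair_realize {α : Type x} (t : L.Term α) (a : α → X) (b : α → Y) :
    pair (t.realize a) (t.realize b) = t.realize fun i => pair (a i) (b i) := by
  have h := toHom_realize (prodAlgHom X Y) t (fun i => ((a i, b i) : X × Y))
  have h' : t.realize (M := prodAlg X Y) (fun i => ((a i, b i) : X × Y)) =
      ((t.realize a, t.realize b) : X × Y) := realize_prod (X := X) (Y := Y) t _
  rw [h'] at h
  exact h

theorem toHom_pair_realize {Z : VarietyCat.{u, v, w} E} (h : X ⨯ Y ⟶ Z) {α : Type x}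
    (t : L.Term α) (a : α → X) (b : α → Y) :
    toHom h (pair (t.realize a) (t.realize b)) =
      t.realize fun i => toHom h (pair (a i) (b i)) := by
  rw [pair_realize, toHom_realize]; rfl

end Products

/-! ### Equalizers as subalgebras. -/

section Equalizers

variable {A B : VarietyCat.{u, v, w} E} (f g : A ⟶ B)

instance eqLocusStructure : L.Structure {a : A // toHom f a = toHom g a} where
  funMap c a := ⟨funMap c fun i => (a i).1, by
    rw [Hom.map_fun, Hom.map_fun]
    congr 1
    funext i
    exact (a i).2⟩
  RelMap r a := RelMap r fun i => (a i).1

theorem realize_eqLocus {α : Type x} (t : L.Term α) (a : α → {a : A // toHom f a = toHom g a}) :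
    (t.realize a).1 = t.realize fun i => (a i).1 := by
  induction t with
  | var => rfl
  | func c ts ih => simp only [Term.realize_func, ← ih]; rfl

/-- The subalgebra on which two morphisms agree. -/
def eqLocus : VarietyCat.{u, v, w} E where
  carrier := {a : A // toHom f a = toHom g a}
  sat e he a := by
    apply Subtype.ext
    rw [realize_eqLocus, realize_eqLocus, A.sat e he]

/-- The inclusion of the subalgebra on which two morphisms agree. -/
def eqLocusι : eqLocus f g ⟶ A :=
  show eqLocus f g →[L] A from
    { toFun := Subtype.val, map_fun' := fun _ _ => rfl, map_rel' := fun _ _ h => h }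

/-- The factorization through the subalgebra on which two morphisms agree. -/
def eqLocusLift {T : VarietyCat.{u, v, w} E} (k : T ⟶ A)
    (h : ∀ t, toHom f (toHom k t) = toHom g (toHom k t)) : T ⟶ eqLocus f g :=
  show T →[L] eqLocus f g from
    { toFun := fun t => ⟨toHom k t, h t⟩
      map_fun' := fun c t => Subtype.ext (Hom.map_fun (toHom k) c t)
      map_rel' := fun r t h => Hom.map_rel (toHom k) r t h }

theorem isRegularMono_eqLocusι : IsRegularMono (eqLocusι f g) :=
  ⟨⟨{ Z := B
      left := f
      right := g
      w := hom_ext fun a => Subtype.property (p := fun a => toHom f a = toHom g a) a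
      isLimit := Fork.IsLimit.mk _
        (fun s => eqLocusLift f g s.ι fun t => toHom_congr s.condition t)
        (fun _ => rfl)
        (fun _ _ h => hom_ext fun t => Subtype.ext (toHom_congr h t)) }⟩⟩

end Equalizers

/-- An equalizer relates exactly the generalized elements on which the parallel pair agrees. -/
theorem relatedBy_iff {R X Z : VarietyCat.{u, v, w} E} {r : R ⟶ X ⨯ X} {h₁ h₂ : X ⨯ X ⟶ Z}
    (hw : r ≫ h₁ = r ≫ h₂) (hr : IsLimit (Fork.ofι r hw)) {T : VarietyCat.{u, v, w} E}
    (a b : T ⟶ X) :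
    RelatedBy r a b ↔ ∀ t, toHom h₁ (pair (toHom a t) (toHom b t)) =
      toHom h₂ (pair (toHom a t) (toHom b t)) := by
  constructor
  · rintro ⟨c, hc⟩ t
    rw [← toHom_lift, ← hc]
    exact toHom_congr hw (toHom c t)
  · intro h
    have h' : prod.lift a b ≫ h₁ = prod.lift a b ≫ h₂ := hom_ext fun t => by
      rw [toHom_comp, toHom_comp, toHom_lift, h]
    exact ⟨Fork.IsLimit.lift hr _ h', Fork.IsLimit.lift_ι' hr _ h'⟩

/-! ### Algebras presented as quotients of term algebras. -/

section Quotients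

variable (E) in
/-- Two terms are equal in all algebras of the variety. -/
def SemEq {α : Type x} (t t' : L.Term α) : Prop :=
  ∀ (A : VarietyCat.{u, v, w} E) (a : α → A), t.realize a = t'.realize a

/-- A congruence on an algebra of terms which contains all identities of the variety is the kernel
of the evaluation of terms in an algebra of the variety. -/
theorem exists_termQuotient {W : Type u} (r : Setoid (L.Term W))
    (hfun : ∀ {n} (c : L.Functions n) (ts ts' : Fin n → L.Term W),
      (∀ i, r (ts i) (ts' i)) → r (Term.func c ts) (Term.func c ts'))
    (hE : ∀ t t', SemEq.{u, v, w} E t t' → r t t') :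
    ∃ (Q : VarietyCat.{u, v, w} E) (a : W → Q), (∀ z : Q, ∃ t : L.Term W, t.realize a = z) ∧
      ∀ t t' : L.Term W, t.realize a = t'.realize a ↔ r t t' := by
  let S : L.Structure (ULift.{w} (Quotient r)) :=
    { funMap := fun c a => ⟨⟦Term.func c fun i => (a i).down.out⟧⟩
      RelMap := fun _ _ => False }
  have key : ∀ {α : Type} (t : L.Term α) (b : α → L.Term W),
      t.realize (fun i => (⟨⟦b i⟧⟩ : ULift.{w} (Quotient r))) = ⟨⟦t.subst b⟧⟩ := by
    intro α t b
    induction t with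
    | var => rfl
    | func c ts ih =>
      rw [Term.realize_func]
      apply ULift.ext
      apply Quotient.sound
      apply hfun
      intro i
      beta_reduce
      rw [ih]
      exact Quotient.mk_out _
  let Q : VarietyCat.{u, v, w} E :=
    { carrier := ULift.{w} (Quotient r)
      str := S
      sat := fun e he a => by
        have ha : a = fun i => (⟨⟦(a i).down.out⟧⟩ : ULift.{w} (Quotient r)) := by
          funext i
          apply ULift.ext
          exact (Quotient.out_eq _).symm
        rw [ha, key, key]
        apply ULift.ext
        apply Quotient.sound
        apply hE
        intro A b
        rw [Term.realize_subst, Term.realize_subst]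
        exact A.sat e he _ }
  -- The same computation as `key`, for variables in `W`, which may live in a higher universe.
  have key' : ∀ t : L.Term W,
      t.realize (M := Q) (fun i => (⟨⟦Term.var i⟧⟩ : ULift.{w} (Quotient r))) = ⟨⟦t⟧⟩ := by
    intro t
    induction t with
    | var => rfl
    | func c ts ih =>
      rw [Term.realize_func]
      apply ULift.ext
      apply Quotient.sound
      apply hfun
      intro i
      beta_reduce
      rw [ih]
      exact Quotient.mk_out _
  refine ⟨Q, fun i => ⟨⟦Term.var i⟧⟩, fun z => ⟨z.down.out, ?_⟩, fun t t' => ?_⟩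
  · rw [key']
    apply ULift.ext
    exact Quotient.out_eq _
  · rw [key', key']
    exact (ULift.ext_iff).trans Quotient.eq

end Quotients

/-! ### From the terms to the Mal'tsev property. -/

section Sufficiency

variable {k m N : ℕ} {f g : Fin k → L.Term (Fin 2)} {p : Fin m → L.Term (Fin 3)}
  {s : Fin N → L.Term (SVars k m)} {σ : Fin (N + 1) → L.Term (SigmaVars k m)}
  {η ε : Fin (N + 1) → Fin 2 → L.Term (Vars k m)}

theorem map₂_args {A B C : Type*} (h : A → B → C) (u : A) (v : Fin k → A) (w : Fin m → A)
    (u' : B) (v' : Fin k → B) (w' : Fin m → B) :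
    (fun i => h (args u v w i) (args u' v' w' i)) =
      args (h u u') (fun j => h (v j) (v' j)) (fun j => h (w j) (w' j)) := by
  funext i
  rcases i with _ | _ | _ <;> rfl

/-- The chain of identities connects `u` with `u'` as soon as the two sides of the equations are
equal at the given elements and `w⃗ = w⃗'`. -/
theorem eq_of_chain {A : VarietyCat.{u, v, w} E} {a a' : A} {b b' : Fin k → A} {c : Fin m → A}
    (hchain : (∀ i : Fin N,
      (σ i.castSucc).realize (sigmaArgs a b c a' b' c
          ((ε i.castSucc 0).realize (args a b c)) ((ε i.castSucc 1).realize (args a' b' c))) =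
        (s i).realize (sArgs a b c c a' b' c c) ∧
      (s i).realize (sArgs a b c c a' b' c c) =
        (σ i.succ).realize (sigmaArgs a b c a' b' c
          ((η i.succ 0).realize (args a b c)) ((η i.succ 1).realize (args a' b' c)))) ∧
      a = (σ 0).realize (sigmaArgs a b c a' b' c
        ((η 0 0).realize (args a b c)) ((η 0 1).realize (args a' b' c))) ∧
      a' = (σ (Fin.last N)).realize (sigmaArgs a b c a' b' c
        ((ε (Fin.last N) 0).realize (args a b c)) ((ε (Fin.last N) 1).realize (args a' b' c))))
    (h : ∀ i α, (η i α).realize (args a b c) = (ε i α).realize (args a b c))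
    (h' : ∀ i α, (η i α).realize (args a' b' c) = (ε i α).realize (args a' b' c)) :
    a = a' := by
  obtain ⟨hstep, h0, hN⟩ := hchain
  have key : ∀ i : Fin (N + 1), a = (σ i).realize (sigmaArgs a b c a' b' c
      ((η i 0).realize (args a b c)) ((η i 1).realize (args a' b' c))) := by
    intro i
    induction i using Fin.induction with
    | zero => exact h0
    | succ i ih =>
      refine ih.trans ?_
      rw [h, h', (hstep i).1, (hstep i).2]
  refine (key (Fin.last N)).trans ?_
  rw [h, h']
  exact hN.symm

/-- Under the term condition, equalizers of parallel pairs `X ⨯ Y ⇉ Z` are difunctional. -/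
theorem difunctional_of_terms
    (hxy : ∀ (A : VarietyCat.{u, v, w} E) (x y : A) (i : Fin (N + 1)) (α : Fin 2),
      (η i α).realize (args y (fun j => (f j).realize ![x, y])
          (fun j => (p j).realize ![x, x, y])) =
        (ε i α).realize (args y (fun j => (f j).realize ![x, y])
          (fun j => (p j).realize ![x, x, y])) ∧
      (η i α).realize (args x (fun j => (g j).realize ![x, y])
          (fun j => (p j).realize ![x, y, y])) =
        (ε i α).realize (args x (fun j => (g j).realize ![x, y])
          (fun j => (p j).realize ![x, y, y])))
    (huvw : ∀ (A : VarietyCat.{u, v, w} E) (u : A) (v : Fin k → A) (w : Fin m → A)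
        (u' : A) (v' : Fin k → A) (w' : Fin m → A),
      (∀ i : Fin N,
        (σ i.castSucc).realize (sigmaArgs u v w u' v' w'
            ((ε i.castSucc 0).realize (args u v w))
            ((ε i.castSucc 1).realize (args u' v' w'))) =
          (s i).realize (sArgs u v w w u' v' w' w') ∧
        (s i).realize (sArgs u v w w' u' v' w' w) =
          (σ i.succ).realize (sigmaArgs u v w u' v' w'
            ((η i.succ 0).realize (args u v w))
            ((η i.succ 1).realize (args u' v' w')))) ∧
      u = (σ 0).realize (sigmaArgs u v w u' v' w'
          ((η 0 0).realize (args u v w)) ((η 0 1).realize (args u' v' w'))) ∧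
      u' = (σ (Fin.last N)).realize (sigmaArgs u v w u' v' w'
          ((ε (Fin.last N) 0).realize (args u v w))
          ((ε (Fin.last N) 1).realize (args u' v' w'))))
    {X Y Z : VarietyCat.{u, v, w} E} (h₁ h₂ : X ⨯ Y ⟶ Z)
    {x₁ x₂ : X} {y₁ y₂ : Y}
    (h11 : toHom h₁ (pair x₁ y₁) = toHom h₂ (pair x₁ y₁))
    (h12 : toHom h₁ (pair x₁ y₂) = toHom h₂ (pair x₁ y₂))
    (h22 : toHom h₁ (pair x₂ y₂) = toHom h₂ (pair x₂ y₂)) :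
    toHom h₁ (pair x₂ y₁) = toHom h₂ (pair x₂ y₁) := by
  have hw : ∀ j, toHom h₁ (pair ((p j).realize ![x₁, x₁, x₂]) ((p j).realize ![y₁, y₂, y₂])) =
      toHom h₂ (pair ((p j).realize ![x₁, x₁, x₂]) ((p j).realize ![y₁, y₂, y₂])) := by
    intro j
    rw [toHom_pair_realize, toHom_pair_realize]
    congr 1
    funext i
    fin_cases i
    · exact h11
    · exact h12
    · exact h22
  have hη : ∀ (h : X ⨯ Y ⟶ Z) (i : Fin (N + 1)) (α : Fin 2),
      (η i α).realize (args (toHom h (pair x₂ y₁))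
        (fun j => toHom h (pair ((f j).realize ![x₁, x₂]) ((g j).realize ![y₁, y₂])))
        (fun j => toHom h (pair ((p j).realize ![x₁, x₁, x₂]) ((p j).realize ![y₁, y₂, y₂])))) =
      (ε i α).realize (args (toHom h (pair x₂ y₁))
        (fun j => toHom h (pair ((f j).realize ![x₁, x₂]) ((g j).realize ![y₁, y₂])))
        (fun j => toHom h
          (pair ((p j).realize ![x₁, x₁, x₂]) ((p j).realize ![y₁, y₂, y₂])))) := by
    intro h i α
    -- Both sides are images under `h` of pairs, so coordinates can be compared separately: the
    -- first identity at `x₁, x₂`, the second at `y₁, y₂`.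
    rw [← map₂_args (fun x y => toHom h (pair x y)), ← toHom_pair_realize, ← toHom_pair_realize,
      (hxy X x₁ x₂ i α).1, (hxy Y y₁ y₂ i α).2]
  have hη₂ := hη h₂
  -- Makes the ternary arguments on both sides literally the same tuple, as `eq_of_chain` requires.
  simp only [← hw] at hη₂
  exact eq_of_chain (huvw Z _ _ _ _ _ _) (hη h₁) hη₂

end Sufficiency

/-- If all equalizers of parallel pairs `X ⨯ X ⇉ Z` are difunctional, then reflexive regular
relations are equivalence relations. -/
theorem isRegMaltsev_of_difunctional
    (hdif : ∀ {X Z : VarietyCat.{u, v, w} E} (h₁ h₂ : X ⨯ X ⟶ Z) {x₁ x₂ y₁ y₂ : X},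
      toHom h₁ (pair x₁ y₁) = toHom h₂ (pair x₁ y₁) →
      toHom h₁ (pair x₁ y₂) = toHom h₂ (pair x₁ y₂) →
      toHom h₁ (pair x₂ y₂) = toHom h₂ (pair x₂ y₂) →
      toHom h₁ (pair x₂ y₁) = toHom h₂ (pair x₂ y₁)) :
    IsRegMaltsev (VarietyCat.{u, v, w} E) := by
  rintro R X r ⟨⟨hr⟩⟩ hrefl T
  have hiff := fun a b : T ⟶ X => relatedBy_iff hr.w hr.isLimit a b
  have hdiag := fun a : T ⟶ X => (hiff a a).1 (hrefl T a)
  refine ⟨hrefl T, fun {a b} hab => ?_, fun {a b c} hab hbc => ?_⟩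
  · rw [hiff] at hab ⊢
    -- From `(a, a), (a, b), (b, b)` to `(b, a)`.
    exact fun t => hdif _ _ (hdiag a t) (hab t) (hdiag b t)
  · rw [hiff] at hab hbc ⊢
    -- From `(b, c), (b, b), (a, b)` to `(a, c)`.
    exact fun t => hdif _ _ (hbc t) (hdiag b t) (hab t)

/-! ### Names of pairs, and the elementary steps between terms. -/

section Necessity

variable (L) in
/-- Names for the elements of the square of the free algebra on `x, y`: the pair `(y, x)`, all
pairs of binary terms, and the pairs `(p(x, x, y), p(x, y, y))` for ternary terms `p`. -/
abbrev PairName : Type u := Unit ⊕ (L.Term (Fin 2) × L.Term (Fin 2)) ⊕ L.Term (Fin 3)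

/-- The first coordinates of the named pairs, evaluated at `x, y`. -/
def firstCoord {A : Type x} [L.Structure A] (x y : A) : PairName L → A :=
  Sum.elim (fun _ => y) (Sum.elim (fun q => q.1.realize ![x, y]) fun p => p.realize ![x, x, y])

/-- The second coordinates of the named pairs, evaluated at `x, y`. -/
def secondCoord {A : Type x} [L.Structure A] (x y : A) : PairName L → A :=
  Sum.elim (fun _ => x) (Sum.elim (fun q => q.2.realize ![x, y]) fun p => p.realize ![x, y, y])

variable (E) in
/-- The terms `t` and `t'` name the same pair. -/
def NameEq (t t' : L.Term (PairName L)) : Prop :=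
  ∀ (A : VarietyCat.{u, v, w} E) (x y : A),
    t.realize (firstCoord x y) = t'.realize (firstCoord x y) ∧
    t.realize (secondCoord x y) = t'.realize (secondCoord x y)

variable (L) in
/-- Names for the elements of the coproduct of two copies of the square of the free algebra. -/
abbrev CoprodName : Type u := PairName L ⊕ PairName L

/-- The part of an assignment concerning the ternary terms. -/
def ternaryPart {A : Type x} (a : PairName L → A) : L.Term (Fin 3) → A :=
  fun p => a (Sum.inr (Sum.inr p))

variable (E) in
/-- `t'` results from `t` by replacing in each copy a name by another name of the same pair. -/
def RenameStep (t t' : L.Term (CoprodName L)) : Prop :=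
  ∃ (σ : L.Term (CoprodName L ⊕ Fin 2)) (η ε : Fin 2 → L.Term (PairName L)),
    (∀ α, NameEq.{u, v, w} E (η α) (ε α)) ∧
    ∀ (A : VarietyCat.{u, v, w} E) (a a' : PairName L → A),
      t.realize (Sum.elim a a') = σ.realize
        (Sum.elim (Sum.elim a a') ![(η 0).realize a, (η 1).realize a']) ∧
      t'.realize (Sum.elim a a') = σ.realize
        (Sum.elim (Sum.elim a a') ![(ε 0).realize a, (ε 1).realize a'])

variable (E) in
/-- `t'` results from `t` by moving ternary terms from one copy to the other. -/
def SwapStep (t t' : L.Term (CoprodName L)) : Prop :=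
  ∃ s : L.Term ((PairName L ⊕ L.Term (Fin 3)) ⊕ (PairName L ⊕ L.Term (Fin 3))),
    ∀ (A : VarietyCat.{u, v, w} E) (a a' : PairName L → A),
      t.realize (Sum.elim a a') = s.realize
        (Sum.elim (Sum.elim a (ternaryPart a)) (Sum.elim a' (ternaryPart a'))) ∧
      t'.realize (Sum.elim a a') = s.realize
        (Sum.elim (Sum.elim a (ternaryPart a')) (Sum.elim a' (ternaryPart a)))

/-- The term `σ` is `t` itself, ignoring its two extra slots. Identities of the variety are thus
absorbed into renamings and need no third kind of step. -/
theorem RenameStep.of_semEq {t t' : L.Term (CoprodName L)} (h : SemEq.{u, v, w} E t t') :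
    RenameStep.{u, v, w} E t t' := by
  refine ⟨t.relabel Sum.inl, fun _ => Term.var (Sum.inl ()), fun _ => Term.var (Sum.inl ()),
    fun _ _ _ _ => ⟨rfl, rfl⟩, fun A a a' => ?_⟩
  simp only [Term.realize_relabel, Sum.elim_comp_inl]
  exact ⟨trivial, (h A _).symm⟩

theorem SwapStep.refl (t : L.Term (CoprodName L)) : SwapStep.{u, v, w} E t t := by
  refine ⟨t.relabel (Sum.map Sum.inl Sum.inl), fun A a a' => ?_⟩
  simp only [Term.realize_relabel, Sum.elim_comp_map, Sum.elim_comp_inl]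
  exact ⟨trivial, trivial⟩

theorem RenameStep.symm {t t' : L.Term (CoprodName L)} :
    RenameStep.{u, v, w} E t t' → RenameStep.{u, v, w} E t' t := by
  rintro ⟨σ, η, ε, h, h'⟩
  exact ⟨σ, ε, η, fun α A x y => ⟨(h α A x y).1.symm, (h α A x y).2.symm⟩,
    fun A a a' => (h' A a a').symm⟩

/-- Exchanging the two extra blocks of ternary variables in `s` reverses the step. -/
theorem SwapStep.symm {t t' : L.Term (CoprodName L)} :
    SwapStep.{u, v, w} E t t' → SwapStep.{u, v, w} E t' t := by
  rintro ⟨s, h⟩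
  refine ⟨s.relabel (Sum.elim (Sum.elim (Sum.inl ∘ Sum.inl) (Sum.inr ∘ Sum.inr))
    (Sum.elim (Sum.inr ∘ Sum.inl) (Sum.inl ∘ Sum.inr))), fun A a a' => ?_⟩
  rw [(h A a a').1, (h A a a').2, Term.realize_relabel, Term.realize_relabel]
  constructor <;> congr 1 <;> funext i <;> rcases i with (_ | _) | (_ | _) <;> rfl

theorem realize_func_update {A : Type x} [L.Structure A] {α : Type*} {n : ℕ} (c : L.Functions n)
    (ts : Fin n → L.Term α) (i : Fin n) (t : L.Term α) (a : α → A) :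
    (Term.func c (Function.update ts i t)).realize a =
      funMap c (Function.update (fun j => (ts j).realize a) i (t.realize a)) := by
  rw [Term.realize_func]
  congr 1
  funext j
  by_cases h : j = i
  · subst h; simp
  · simp [h]

theorem RenameStep.func_update {t t' : L.Term (CoprodName L)} (h : RenameStep.{u, v, w} E t t')
    {n : ℕ} (c : L.Functions n) (ts : Fin n → L.Term (CoprodName L)) (i : Fin n) :
    RenameStep.{u, v, w} E (Term.func c (Function.update ts i t))
      (Term.func c (Function.update ts i t')) := by
  obtain ⟨σ, η, ε, h, h'⟩ := h
  refine ⟨Term.func c (Function.update (fun j => (ts j).relabel Sum.inl) i σ), η, ε, h,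
    fun A a a' => ?_⟩
  simp only [realize_func_update, Term.realize_relabel, Sum.elim_comp_inl, (h' A a a').1,
    (h' A a a').2, and_self]

theorem SwapStep.func_update {t t' : L.Term (CoprodName L)} (h : SwapStep.{u, v, w} E t t')
    {n : ℕ} (c : L.Functions n) (ts : Fin n → L.Term (CoprodName L)) (i : Fin n) :
    SwapStep.{u, v, w} E (Term.func c (Function.update ts i t))
      (Term.func c (Function.update ts i t')) := by
  obtain ⟨s, h⟩ := h
  refine ⟨Term.func c (Function.update
    (fun j => (ts j).relabel (Sum.map Sum.inl Sum.inl)) i s), fun A a a' => ?_⟩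
  simp only [realize_func_update, Term.realize_relabel, Sum.elim_comp_map, Sum.elim_comp_inl,
    (h A a a').1, (h A a a').2, and_self]

/-! ### The congruence generated by the steps. -/

variable (E) in
/-- The congruence on terms defining the cokernel pair of the relation generated by
`(x, x), (x, y), (y, y)`. -/
def cokerRel : L.Term (CoprodName L) → L.Term (CoprodName L) → Prop :=
  Relation.ReflTransGen fun t t' => RenameStep.{u, v, w} E t t' ∨ SwapStep.{u, v, w} E t t'

theorem cokerRel.symm {t t' : L.Term (CoprodName L)} (h : cokerRel.{u, v, w} E t t') :
    cokerRel.{u, v, w} E t' t :=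
  haveI : Std.Symm fun t t' : L.Term (CoprodName L) =>
    RenameStep.{u, v, w} E t t' ∨ SwapStep.{u, v, w} E t t' :=
    ⟨fun _ _ => Or.imp RenameStep.symm SwapStep.symm⟩
  Relation.ReflTransGen.stdSymm.symm _ _ h

/-- The arguments are changed one at a time, since a step is known to pass through an operation only
in a single argument. -/
theorem cokerRel.func {n : ℕ} (c : L.Functions n) (ts ts' : Fin n → L.Term (CoprodName L))
    (h : ∀ i, cokerRel.{u, v, w} E (ts i) (ts' i)) :
    cokerRel.{u, v, w} E (Term.func c ts) (Term.func c ts') := by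
  have hupd : ∀ (r : Fin n → L.Term (CoprodName L)) (i : Fin n) (t t' : L.Term (CoprodName L)),
      cokerRel.{u, v, w} E t t' → cokerRel.{u, v, w} E (Term.func c (Function.update r i t))
        (Term.func c (Function.update r i t')) := by
    intro r i t t' htt'
    exact Relation.ReflTransGen.lift (fun t => Term.func c (Function.update r i t))
      (fun _ _ => Or.imp (fun h => RenameStep.func_update h c r i)
        (fun h => SwapStep.func_update h c r i)) _ _ htt'
  have key : ∀ S : Finset (Fin n),
      cokerRel.{u, v, w} E (Term.func c ts) (Term.func c (S.piecewise ts' ts)) := by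
    intro S
    induction S using Finset.induction with
    | empty => rw [Finset.piecewise_empty]; exact Relation.ReflTransGen.refl
    | insert i S hi ih =>
      refine ih.trans ?_
      rw [Finset.piecewise_insert]
      have := hupd (S.piecewise ts' ts) i (ts i) (ts' i) (h i)
      rwa [Function.update_eq_self_iff.2 (Finset.piecewise_eq_of_notMem S ts' ts hi).symm] at this
  have := key Finset.univ
  rwa [Finset.piecewise_univ] at this

variable (E) in
/-- The setoid underlying the congruence `cokerRel`. -/
def cokerSetoid : Setoid (L.Term (CoprodName L)) where
  r := cokerRel.{u, v, w} E
  iseqv := ⟨fun _ => Relation.ReflTransGen.refl, cokerRel.symm, Relation.ReflTransGen.trans⟩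

theorem cokerRel_of_nameEq_left {t t' : L.Term (PairName L)} (h : NameEq.{u, v, w} E t t') :
    cokerRel.{u, v, w} E (t.relabel Sum.inl) (t'.relabel Sum.inl) := by
  refine Relation.ReflTransGen.single (Or.inl ⟨Term.var (Sum.inr 0), fun _ => t, fun _ => t',
    fun _ => h, fun A a a' => ?_⟩)
  simp

theorem cokerRel_of_nameEq_right {t t' : L.Term (PairName L)} (h : NameEq.{u, v, w} E t t') :
    cokerRel.{u, v, w} E (t.relabel Sum.inr) (t'.relabel Sum.inr) := by
  refine Relation.ReflTransGen.single (Or.inl ⟨Term.var (Sum.inr 1), fun _ => t, fun _ => t',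
    fun _ => h, fun A a a' => ?_⟩)
  simp

theorem cokerRel_swap (p : L.Term (Fin 3)) :
    cokerRel.{u, v, w} E (Term.var (Sum.inl (Sum.inr (Sum.inr p))))
      (Term.var (Sum.inr (Sum.inr (Sum.inr p)))) :=
  Relation.ReflTransGen.single (Or.inr ⟨Term.var (Sum.inl (Sum.inr p)),
    fun _ _ _ => ⟨rfl, rfl⟩⟩)

/-- Related terms are connected by an alternating sequence of the two kinds of steps. -/
theorem cokerRel.exists_chain {t t' : L.Term (CoprodName L)} (h : cokerRel.{u, v, w} E t t') :
    ∃ (N : ℕ) (a b : Fin (N + 1) → L.Term (CoprodName L)), a 0 = t ∧ b (Fin.last N) = t' ∧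
      (∀ i, RenameStep.{u, v, w} E (a i) (b i)) ∧
      ∀ i : Fin N, SwapStep.{u, v, w} E (b i.castSucc) (a i.succ) := by
  have hrefl : ∀ t : L.Term (CoprodName L), RenameStep.{u, v, w} E t t :=
    fun t => .of_semEq fun _ _ => rfl
  induction h with
  | refl => exact ⟨0, fun _ => t, fun _ => t, rfl, rfl, fun _ => hrefl t, fun i => i.elim0⟩
  | @tail b₁ c₁ _ hstep ih =>
    obtain ⟨N, a, b, ha, hb, hren, hswap⟩ := ih
    -- A trivial step of the missing kind restores the alternation.
    have hex : ∃ d, SwapStep.{u, v, w} E b₁ d ∧ RenameStep.{u, v, w} E d c₁ := by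
      rcases hstep with h | h
      · exact ⟨b₁, SwapStep.refl b₁, h⟩
      · exact ⟨c₁, h, hrefl c₁⟩
    obtain ⟨d, hd, hd'⟩ := hex
    refine ⟨N + 1, Fin.snoc (α := fun _ => _) a d, Fin.snoc (α := fun _ => _) b c₁,
      ?_, ?_, fun i => ?_, fun i => ?_⟩
    · rw [← ha]
      exact Fin.snoc_castSucc (α := fun _ => L.Term (CoprodName L)) d a 0
    · rw [Fin.snoc_last]
    · induction i using Fin.lastCases with
      | last => simpa using hd'
      | cast i => simpa using hren i
    · induction i using Fin.lastCases with
      | last => simpa [hb] using hd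
      | cast i =>
        rw [Fin.snoc_castSucc, Fin.succ_castSucc, Fin.snoc_castSucc]
        exact hswap i

/-! ### The free algebra on two generators and its square. -/

variable (E) in
/-- The elements `x` and `y` freely generate the algebra `X`. -/
structure IsFreeOn {X : VarietyCat.{u, v, w} E} (x y : X) : Prop where
  exists_term : ∀ z : X, ∃ t : L.Term (Fin 2), t.realize ![x, y] = z
  semEq : ∀ t t' : L.Term (Fin 2), t.realize ![x, y] = t'.realize ![x, y] →
    SemEq.{u, v, w} E t t'

variable (E) in
theorem exists_isFreeOn : ∃ (X : VarietyCat.{u, v, w} E) (x y : X), IsFreeOn E x y := by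
  obtain ⟨X, a, hsurj, hker⟩ := exists_termQuotient.{u, v, w} (E := E) (W := ULift.{u} (Fin 2))
    { r := SemEq.{u, v, w} E
      iseqv := ⟨fun _ _ _ => rfl, fun h A b => (h A b).symm,
        fun h h' A b => (h A b).trans (h' A b)⟩ }
    (fun c ts ts' h A b => congrArg (funMap c) (funext fun i => h i A b)) (fun _ _ h => h)
  have ha : ![a ⟨0⟩, a ⟨1⟩] = a ∘ ULift.up := by
    funext i
    fin_cases i <;> rfl
  refine ⟨X, a ⟨0⟩, a ⟨1⟩, fun z => ?_, fun t t' h A b => ?_⟩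
  · obtain ⟨t, rfl⟩ := hsurj z
    refine ⟨t.relabel ULift.down, ?_⟩
    rw [ha, Term.realize_relabel]
    rfl
  · rw [ha, ← Term.realize_relabel, ← Term.realize_relabel, hker] at h
    have := h A (b ∘ ULift.down)
    rwa [Term.realize_relabel, Term.realize_relabel] at this

/-- Binary terms for the first coordinates of the named pairs. -/
def firstTerm : PairName L → L.Term (Fin 2) :=
  Sum.elim (fun _ => Term.var 1)
    (Sum.elim Prod.fst fun p => p.subst ![Term.var 0, Term.var 0, Term.var 1])

/-- Binary terms for the second coordinates of the named pairs. -/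
def secondTerm : PairName L → L.Term (Fin 2) :=
  Sum.elim (fun _ => Term.var 0)
    (Sum.elim Prod.snd fun p => p.subst ![Term.var 0, Term.var 1, Term.var 1])

theorem realize_subst_firstTerm {A : Type x} [L.Structure A] (x y : A)
    (t : L.Term (PairName L)) :
    (t.subst firstTerm).realize ![x, y] = t.realize (firstCoord x y) := by
  rw [Term.realize_subst]
  congr 1
  funext i
  rcases i with _ | _ | p
  · rfl
  · rfl
  · refine Term.realize_subst.trans ?_
    refine congrArg (fun a => p.realize a) (funext fun j => ?_)
    fin_cases j <;> rfl

theorem realize_subst_secondTerm {A : Type x} [L.Structure A] (x y : A)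
    (t : L.Term (PairName L)) :
    (t.subst secondTerm).realize ![x, y] = t.realize (secondCoord x y) := by
  rw [Term.realize_subst]
  congr 1
  funext i
  rcases i with _ | _ | p
  · rfl
  · rfl
  · refine Term.realize_subst.trans ?_
    refine congrArg (fun a => p.realize a) (funext fun j => ?_)
    fin_cases j <;> rfl

/-- Substituting binary terms for the names turns each coordinate into an equation between binary
terms at the free generators, hence into an identity. -/
theorem IsFreeOn.nameEq {X : VarietyCat.{u, v, w} E} {x y : X} (hX : IsFreeOn E x y)
    {t t' : L.Term (PairName L)}
    (h₁ : t.realize (firstCoord x y) = t'.realize (firstCoord x y))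
    (h₂ : t.realize (secondCoord x y) = t'.realize (secondCoord x y)) :
    NameEq.{u, v, w} E t t' := by
  simp only [← realize_subst_firstTerm, ← realize_subst_secondTerm] at h₁ h₂
  intro A a b
  simp only [← realize_subst_firstTerm, ← realize_subst_secondTerm]
  exact ⟨hX.semEq _ _ h₁ A _, hX.semEq _ _ h₂ A _⟩

/-- The square of the free algebra is presented by the names of its elements. -/
theorem IsFreeOn.exists_hom [L.IsAlgebraic] {X : VarietyCat.{u, v, w} E} {x y : X}
    (hX : IsFreeOn E x y) {Q : VarietyCat.{u, v, w} E} (b : PairName L → Q)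
    (hb : ∀ t t', NameEq.{u, v, w} E t t' → t.realize b = t'.realize b) :
    ∃ h : X ⨯ X ⟶ Q, ∀ t : L.Term (PairName L),
      toHom h (pair (t.realize (firstCoord x y)) (t.realize (secondCoord x y))) =
        t.realize b := by
  have hname : ∀ z : (X ⨯ X : VarietyCat.{u, v, w} E), ∃ t : L.Term (PairName L),
      pair (t.realize (firstCoord x y)) (t.realize (secondCoord x y)) = z := by
    intro z
    obtain ⟨t₁, h₁⟩ := hX.exists_term (toHom prod.fst z)
    obtain ⟨t₂, h₂⟩ := hX.exists_term (toHom prod.snd z)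
    refine ⟨Term.var (Sum.inr (Sum.inl (t₁, t₂))), ?_⟩
    rw [← pair_fst_snd z, ← h₁, ← h₂]
    rfl
  choose name hname using hname
  have huniq : ∀ t t' : L.Term (PairName L),
      pair (t.realize (firstCoord x y)) (t.realize (secondCoord x y)) =
        pair (t'.realize (firstCoord x y)) (t'.realize (secondCoord x y)) →
      t.realize b = t'.realize b := by
    intro t t' h
    have h₁ := congrArg (toHom (prod.fst : X ⨯ X ⟶ X)) h
    have h₂ := congrArg (toHom (prod.snd : X ⨯ X ⟶ X)) h
    rw [fst_pair, fst_pair] at h₁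
    rw [snd_pair, snd_pair] at h₂
    exact hb t t' (hX.nameEq h₁ h₂)
  -- By `huniq` the value does not depend on the chosen name, so the composite of names may serve as
  -- the name of a composite.
  refine ⟨ofMap (fun z => (name z).realize b) fun c z => ?_, fun t => huniq _ _ (hname _)⟩
  refine huniq _ (Term.func c fun i => name (z i)) ?_
  rw [hname, pair_realize, Term.realize_func]
  congr 1
  funext i
  rw [← pair_realize, hname]

/-- In a regular Mal'tsev variety the pair `(y, x)` belongs to the regular relation generated by
`(x, x), (x, y), (y, y)`. -/
theorem cokerRel_of_isRegMaltsev [L.IsAlgebraic] (hM : IsRegMaltsev (VarietyCat.{u, v, w} E)) :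
    cokerRel.{u, v, w} E (Term.var (Sum.inl (Sum.inl ()))) (Term.var (Sum.inr (Sum.inl ()))) := by
  obtain ⟨X, x, y, hX⟩ := exists_isFreeOn.{u, v, w} E
  obtain ⟨Q, e, -, hker⟩ := exists_termQuotient.{u, v, w} (cokerSetoid.{u, v, w} E)
    cokerRel.func fun t t' h => Relation.ReflTransGen.single (Or.inl (.of_semEq h))
  obtain ⟨h₁, hh₁⟩ := hX.exists_hom (e ∘ Sum.inl) fun t t' h => by
    rw [← Term.realize_relabel, ← Term.realize_relabel]
    exact (hker _ _).2 (cokerRel_of_nameEq_left h)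
  obtain ⟨h₂, hh₂⟩ := hX.exists_hom (e ∘ Sum.inr) fun t t' h => by
    rw [← Term.realize_relabel, ← Term.realize_relabel]
    exact (hker _ _).2 (cokerRel_of_nameEq_right h)
  have hternary : ∀ p : L.Term (Fin 3),
      toHom h₁ (pair (p.realize ![x, x, y]) (p.realize ![x, y, y])) =
        toHom h₂ (pair (p.realize ![x, x, y]) (p.realize ![x, y, y])) := fun p =>
    (hh₁ (Term.var (Sum.inr (Sum.inr p)))).trans
      (((hker _ _).2 (cokerRel_swap p)).trans (hh₂ (Term.var (Sum.inr (Sum.inr p)))).symm)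
  have hrefl : IsReflexiveRelation (eqLocusι h₁ h₂) := by
    intro T a
    refine ⟨eqLocusLift h₁ h₂ (prod.lift a a) fun t => ?_, rfl⟩
    rw [toHom_lift]
    obtain ⟨q, hq⟩ := hX.exists_term (toHom a t)
    -- A binary term read as a ternary one without its middle variable names a diagonal pair.
    have := hternary (q.relabel ![0, 2])
    have e₁ : ![x, x, y] ∘ ![0, 2] = ![x, y] := by funext i; fin_cases i <;> rfl
    have e₂ : ![x, y, y] ∘ ![0, 2] = ![x, y] := by funext i; fin_cases i <;> rfl
    rwa [Term.realize_relabel, Term.realize_relabel, e₁, e₂, hq] at this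
  have hequiv := hM (eqLocusι h₁ h₂) (isRegularMono_eqLocusι h₁ h₂) hrefl (eqLocus h₁ h₂)
  -- Symmetry is applied to the generic related pair, the two projections of the relation itself.
  obtain ⟨c, hc⟩ := hequiv.symm (x := eqLocusι h₁ h₂ ≫ prod.fst)
    (y := eqLocusι h₁ h₂ ≫ prod.snd) ⟨𝟙 _, by
      rw [Category.id_comp, ← prod.comp_lift, prod.lift_fst_snd, Category.comp_id]⟩
  -- The middle variable takes the value `x` at `(x, x, y)` and `y` at `(x, y, y)`.
  let z : eqLocus h₁ h₂ := ⟨pair x y, hternary (Term.var 1)⟩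
  have hz : toHom (eqLocusι h₁ h₂) (toHom c z) = pair y x := by
    refine (toHom_congr hc z).trans ?_
    rw [toHom_lift]
    exact congrArg₂ pair (snd_pair x y) (fst_pair x y)
  have hyx : toHom h₁ (pair y x) = toHom h₂ (pair y x) := by
    rw [← hz]
    exact (toHom c z).2
  exact (hker _ _).1 ((hh₁ (Term.var (Sum.inl ()))).symm.trans
    (hyx.trans (hh₂ (Term.var (Sum.inl ())))))

theorem realize_congr_of_varFinset {A : Type x} [L.Structure A] {α : Type*} [DecidableEq α]
    (t : L.Term α) {a b : α → A} (h : ∀ i ∈ t.varFinset, a i = b i) :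
    t.realize a = t.realize b := by
  induction t with
  | var i => exact h i (Finset.mem_singleton_self i)
  | func c ts ih =>
    rw [Term.realize_func, Term.realize_func]
    congr 1
    funext j
    exact ih j fun i hi => h i (Finset.mem_biUnion.2 ⟨j, Finset.mem_univ j, hi⟩)

/-- A default element is added to `S`, so that elements outside `S` have somewhere to go even when
`S` is empty. -/
theorem exists_fin_retract {α : Type x} [Nonempty α] {S : Set α} (hS : S.Finite) :
    ∃ (k : ℕ) (ι : Fin k → α) (ρ : α → Fin k), ∀ a ∈ S, ι (ρ a) = a := by
  classical
  obtain ⟨d⟩ := ‹Nonempty α›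
  let S' := insert d hS.toFinset
  refine ⟨S'.card, fun i => (S'.equivFin.symm i).1, fun a => S'.equivFin
    (if h : a ∈ S' then ⟨a, h⟩ else ⟨d, Finset.mem_insert_self _ _⟩), fun a ha => ?_⟩
  have h : a ∈ S' := Finset.mem_insert_of_mem (hS.mem_toFinset.2 ha)
  simp [h]

end Necessity

end VarietyCat

/-! ### The characterization. -/

open VarietyCat in
theorem mainTheorem2 {L : FirstOrder.Language.{u, v}} [L.IsAlgebraic]
    (E : Set (L.Term ℕ × L.Term ℕ)) :
    IsRegMaltsev (VarietyCat.{u, v, w} E) ↔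
      ∃ (k m N : ℕ) (f g : Fin k → L.Term (Fin 2)) (p : Fin m → L.Term (Fin 3))
        (s : Fin N → L.Term (SVars k m)) (σ : Fin (N + 1) → L.Term (SigmaVars k m))
        (η ε : Fin (N + 1) → Fin 2 → L.Term (Vars k m)),
        -- identities in the variables `x, y`
        (∀ (A : VarietyCat.{u, v, w} E) (x y : A) (i : Fin (N + 1)) (α : Fin 2),
          (η i α).realize (args y (fun j => (f j).realize ![x, y])
              (fun j => (p j).realize ![x, x, y])) =
            (ε i α).realize (args y (fun j => (f j).realize ![x, y])
              (fun j => (p j).realize ![x, x, y])) ∧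
          (η i α).realize (args x (fun j => (g j).realize ![x, y])
              (fun j => (p j).realize ![x, y, y])) =
            (ε i α).realize (args x (fun j => (g j).realize ![x, y])
              (fun j => (p j).realize ![x, y, y]))) ∧
        -- identities in the variables `u, v⃗, w⃗, u', v⃗', w⃗'`
        (∀ (A : VarietyCat.{u, v, w} E) (u : A) (v : Fin k → A) (w : Fin m → A)
            (u' : A) (v' : Fin k → A) (w' : Fin m → A),
          (∀ i : Fin N,
            (σ i.castSucc).realize (sigmaArgs u v w u' v' w'
                ((ε i.castSucc 0).realize (args u v w))
                ((ε i.castSucc 1).realize (args u' v' w'))) =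
              (s i).realize (sArgs u v w w u' v' w' w') ∧
            (s i).realize (sArgs u v w w' u' v' w' w) =
              (σ i.succ).realize (sigmaArgs u v w u' v' w'
                ((η i.succ 0).realize (args u v w))
                ((η i.succ 1).realize (args u' v' w')))) ∧
          u = (σ 0).realize (sigmaArgs u v w u' v' w'
              ((η 0 0).realize (args u v w)) ((η 0 1).realize (args u' v' w'))) ∧
          u' = (σ (Fin.last N)).realize (sigmaArgs u v w u' v' w'
              ((ε (Fin.last N) 0).realize (args u v w))
              ((ε (Fin.last N) 1).realize (args u' v' w')))) := by
  classical
  constructor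
  · intro hM
    obtain ⟨N, a, b, ha, hb, hren, hswap⟩ := (cokerRel_of_isRegMaltsev hM).exists_chain
    choose σ η ε hname hσ using hren
    choose s hs using hswap
    -- Only names in `η` and `ε` must keep their meaning. The identities for `s` and `σ` hold under
    -- every assignment, so they survive any renaming that respects the three kinds of names.
    let S : Finset (PairName L) := Finset.univ.biUnion fun i : Fin (N + 1) =>
      Finset.univ.biUnion fun α : Fin 2 => (η i α).varFinset ∪ (ε i α).varFinset
    have hηS : ∀ i α j, j ∈ (η i α).varFinset → j ∈ S := fun i α j hj => by
      simp only [S, Finset.mem_biUnion, Finset.mem_univ, true_and]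
      exact ⟨i, α, Finset.mem_union_left _ hj⟩
    have hεS : ∀ i α j, j ∈ (ε i α).varFinset → j ∈ S := fun i α j hj => by
      simp only [S, Finset.mem_biUnion, Finset.mem_univ, true_and]
      exact ⟨i, α, Finset.mem_union_right _ hj⟩
    have : Nonempty (L.Term (Fin 2) × L.Term (Fin 2)) := ⟨(Term.var 0, Term.var 0)⟩
    have : Nonempty (L.Term (Fin 3)) := ⟨Term.var 0⟩
    obtain ⟨k, ι, ρ, hρ⟩ := exists_fin_retract (S.finite_toSet.preimage
      (f := fun q : L.Term (Fin 2) × L.Term (Fin 2) => Sum.inr (Sum.inl q))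
      (Sum.inr_injective.comp Sum.inl_injective).injOn)
    obtain ⟨m, ι', ρ', hρ'⟩ := exists_fin_retract (S.finite_toSet.preimage
      (f := fun q : L.Term (Fin 3) => Sum.inr (Sum.inr q))
      (Sum.inr_injective.comp Sum.inr_injective).injOn)
    let R : PairName L → Vars k m := Sum.map id (Sum.map ρ ρ')
    have hfirst : ∀ (A : VarietyCat.{u, v, w} E) (x y : A), ∀ j ∈ S,
        args y (fun j => (ι j).1.realize ![x, y]) (fun j => (ι' j).realize ![x, x, y]) (R j) =
          firstCoord x y j := by
      rintro A x y (_ | q | q) hj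
      · rfl
      · exact congrArg (fun q => q.1.realize ![x, y]) (hρ q hj)
      · exact congrArg (fun q => q.realize ![x, x, y]) (hρ' q hj)
    have hsecond : ∀ (A : VarietyCat.{u, v, w} E) (x y : A), ∀ j ∈ S,
        args x (fun j => (ι j).2.realize ![x, y]) (fun j => (ι' j).realize ![x, y, y]) (R j) =
          secondCoord x y j := by
      rintro A x y (_ | q | q) hj
      · rfl
      · exact congrArg (fun q => q.2.realize ![x, y]) (hρ q hj)
      · exact congrArg (fun q => q.realize ![x, y, y]) (hρ' q hj)
    refine ⟨k, m, N, fun j => (ι j).1, fun j => (ι j).2, ι',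
      -- The extra ternary slots use the same `ρ'` as `R`, so that `ternaryPart (args u v w ∘ R)` is
      -- `w ∘ ρ'`.
      fun i => (s i).relabel (Sum.map (Sum.map R ρ') (Sum.map R ρ')),
      fun i => (σ i).relabel (Sum.map (Sum.map R R) id),
      fun i α => (η i α).relabel R, fun i α => (ε i α).relabel R,
      fun A x y i α => ?_, fun A u v w u' v' w' => ?_⟩
    · simp only [Term.realize_relabel]
      obtain ⟨h₁, h₂⟩ := hname i α A x y
      constructor
      · refine (realize_congr_of_varFinset _ fun j hj => hfirst A x y j (hηS i α j hj)).trans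
          (h₁.trans ?_)
        exact (realize_congr_of_varFinset _ fun j hj => hfirst A x y j (hεS i α j hj)).symm
      · refine (realize_congr_of_varFinset _ fun j hj => hsecond A x y j (hηS i α j hj)).trans
          (h₂.trans ?_)
        exact (realize_congr_of_varFinset _ fun j hj => hsecond A x y j (hεS i α j hj)).symm
    · have hσ' := fun i => hσ i A (args u v w ∘ R) (args u' v' w' ∘ R)
      have hs' := fun i => hs i A (args u v w ∘ R) (args u' v' w' ∘ R)
      simp only [Term.realize_relabel, sigmaArgs, sArgs, Sum.elim_comp_map, Function.comp_id]
      refine ⟨fun i => ⟨(hσ' i.castSucc).2.symm.trans (hs' i).1,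
        (hs' i).2.symm.trans (hσ' i.succ).1⟩, ?_, ?_⟩
      · refine Eq.trans ?_ (hσ' 0).1
        rw [ha]
        rfl
      · refine Eq.trans ?_ (hσ' (Fin.last N)).2
        rw [hb]
        rfl
  · rintro ⟨k, m, N, f, g, p, s, σ, η, ε, hxy, huvw⟩
    exact isRegMaltsev_of_difunctional fun h₁ h₂ => difunctional_of_terms hxy huvw h₁ h₂
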